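/- Let $N\ge 0$ be an integer, let $p_1,\dots,p_N,s_1,\dots,s_N\in\mathbb C$ with $p_j\ne 0$ for all $j$ and $p_j+p_k\ne 0$ for all $j\ne k$, and let $\sigma\in\{i,-i\}$. For $(x,t)\in\mathbb R^2$ put $$\lambda_j=p_jx-\tfrac14p_j^3t+s_j,\qquad \eta_{jk}=\frac{(p_j-p_k)^2}{(p_j+p_k)^2},\qquad \eta_S=\prod_{j,k\in S,\ j<k}\eta_{jk}\quad(S\subseteq\{1,\dots,N\}),$$ (so $\eta_S=1$ if $|S|\le 1$), and define $$f_N=\sum_{S\subseteq\{1,\dots,N\}}\eta_S\exp\Big(\sum_{j\in S}\lambda_j\Big),\qquad g_N=\sum_{S\subseteq\{1,\dots,N\}}(-1)^{|S|}\eta_S\exp\Big(\sum_{j\in S}\lambda_j\Big),$$ $$f_{N-1}(\hat n)=\sum_{S\subseteq\{1,\dots,N\}\setminus\{n\}}\eta_S\exp\Big(\sum_{j\in S}\lambda_j\Big),\qquad H_N=4\sum_{n=1}^N\frac{f_{N-1}(\hat n)}{p_n}.$$ Then the following hold. (a) For all $(x,t)\in\mathbb R^2$, $\;H_{N,x}f_N-H_Nf_{N,x}+f_N^2-g_N^2=0$.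 (b) For each $t$, the indefinite $x$-integral of $(f_N/g_N)^{-2}$ is $$\int\Big(\frac{f_N}{g_N}\Big)^{-2}dx=x+\frac{H_N}{f_N}$$ up to an additive constant. That is, on every open interval on which $f_N(\cdot,t)$ does not vanish, the antiderivatives of $(f_N/g_N)^{-2}$ (read as $g_N^2/f_N^2$ at zeros of $g_N$) are exactly the functions $x+H_N/f_N+C$ with $C\in\mathbb C$. (c) For every $c\in\mathbb C$, with the integral taken to be $x+H_N/f_N$, the function $$w_N=\sigma\Big(\frac{f_N}{g_N}\Big)^2\int\Big(\frac{f_N}{g_N}\Big)^{-2}dx+c\Big(\frac{f_N}{g_N}\Big)^2=\sigma\Big(\frac{f_N}{g_N}\Big)^2\Big(x+\frac{H_N}{f_N}\Big)+c\Big(\frac{f_N}{g_N}\Big)^2$$ is smooth on the open set of all $(x,t)\in\mathbb R^2$ at which $f_N\ne 0$, $g_N\ne 0$ and $w_N\ne0$, and satisfies there the Calogero Korteweg–de Vries equation $$w_t+\frac14w_{xxx}+\frac{3w_x}{8w^2}+\frac{3w_x^3}{8w^2}-\frac{3w_xw_{xx}}{4w}=0.$$ -/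

import Mathlib

open scoped ContDiff

noncomputable section

namespace CKdV

/-- The phase `λ_j = p_j x + r_j t + s_j` with `r_j = -p_j³ / 4`. -/
def phase {N : ℕ} (p s : Fin N → ℂ) (j : Fin N) (x t : ℝ) : ℂ :=
  p j * (x : ℂ) + (-(1 / 4) * p j ^ 3) * (t : ℂ) + s j

/-- The pair coefficient `η_{jk} = (p_j - p_k)² / (p_j + p_k)²`. -/
def etaPair {N : ℕ} (p : Fin N → ℂ) (j k : Fin N) : ℂ :=
  (p j - p k) ^ 2 / (p j + p k) ^ 2

/-- `η_{i_1 ⋯ i_n}` for `S = {i_1 < ⋯ < i_n}`: the product of `η_{jk}` over all pairs `j < k`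
in `S`. It is `1` when `S` has at most one element. -/
def eta {N : ℕ} (p : Fin N → ℂ) (S : Finset (Fin N)) : ℂ :=
  ∏ j ∈ S, ∏ k ∈ S with j < k, etaPair p j k

/-- The function `f` built from the indices in `A`:
`∑_{S ⊆ A} η_S exp (∑_{j ∈ S} λ_j)`; the empty set contributes the leading `1`. -/
def fSub {N : ℕ} (p s : Fin N → ℂ) (A : Finset (Fin N)) (x t : ℝ) : ℂ :=
  ∑ S ∈ A.powerset, eta p S * Complex.exp (∑ j ∈ S, phase p s j x t)

/-- `f_N`. -/
def f {N : ℕ} (p s : Fin N → ℂ) (x t : ℝ) : ℂ :=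
  fSub p s Finset.univ x t

/-- `g_N`: as `f_N`, with the sign `(-1)^n` on the terms with `n` indices. -/
def g {N : ℕ} (p s : Fin N → ℂ) (x t : ℝ) : ℂ :=
  ∑ S : Finset (Fin N),
    (-1) ^ S.card * eta p S * Complex.exp (∑ j ∈ S, phase p s j x t)

/-- `H_N = 4 ∑_n f_{N-1}(n̂) / p_n`, where `f_{N-1}(n̂)` is built like `f_N` from all the
indices except `n`. -/
def H {N : ℕ} (p s : Fin N → ℂ) (x t : ℝ) : ℂ :=
  4 * ∑ n : Fin N, fSub p s (Finset.univ.erase n) x t / p n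

/-- The function `x + H_N / f_N`. -/
def primitive {N : ℕ} (p s : Fin N → ℂ) (x t : ℝ) : ℂ :=
  (x : ℂ) + H p s x t / f p s x t

/-- `σ (f_N/g_N)² Φ + c (f_N/g_N)²`, where `Φ` stands for the indefinite `x`-integral of
`(f_N/g_N)⁻²`. -/
def wOf {N : ℕ} (σ c : ℂ) (p s : Fin N → ℂ) (Φ : ℝ → ℝ → ℂ) (x t : ℝ) : ℂ :=
  σ * (f p s x t / g p s x t) ^ 2 * Φ x t + c * (f p s x t / g p s x t) ^ 2

/-- `w` is a smooth, nowhere vanishing classical solution on the open set `U` of the `(x,t)`-plane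
of `w_t + w_xxx / 4 + 3 w_x / (8 w²) + 3 w_x³ / (8 w²) - 3 w_x w_xx / (4 w) = 0`. -/
def SolvesCKdVOn (w : ℝ → ℝ → ℂ) (U : Set (ℝ × ℝ)) : Prop :=
  IsOpen U ∧ ContDiffOn ℝ ∞ (fun z : ℝ × ℝ => w z.1 z.2) U ∧
  ∀ x t : ℝ, (x, t) ∈ U → w x t ≠ 0 ∧
    deriv (fun τ => w x τ) t
      + 1 / 4 * iteratedDeriv 3 (fun y => w y t) x
      + 3 * deriv (fun y => w y t) x / (8 * w x t ^ 2)
      + 3 * deriv (fun y => w y t) x ^ 3 / (8 * w x t ^ 2)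
      - 3 * deriv (fun y => w y t) x * iteratedDeriv 2 (fun y => w y t) x / (4 * w x t) = 0

end CKdV

end

namespace CKdV

open Matrix Finset

/-! The subset sums are Cauchy determinants. With `P = diag(p)`, `C = cauchy p`, `W =
diag(exp(-λ_j)/(2 p_j))` and `M = W + C` (`dressed`), `f` is a nonvanishing factor times `det M`.
Everything then reduces to the moments `m_ij = ∑ p_a^i (M⁻¹)_ab p_b^j`: where `f ≠ 0`, `θ = g/f = 1
- m_(-1,0)` (`g_eq`) and `H/f = 4 ∑ 1/p_n - 2 m_(-1,-1)` (`H_eq`).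

Since `P C + C P` is the all-ones matrix, of rank one, the `x`- and `t`-derivatives of moments are
quadratic polynomials in moments (`hasDerivAt_moment_x`, `hasDerivAt_moment_t`), and `moment_shift`
relates moments of different indices. This yields a KdV Lax pair at zero spectral parameter: `θ_xx =
u θ` and `4 θ_t = 2 u θ_x - u_x θ`, with `u = -∂_x m_00`. The function `Φ = x + H/f` satisfies `Φ_x
= θ²` and `Φ_t = θ_x² - θ θ_xx / 2`. The first relation gives the integral formula; all of them
together turn the equation for `w = (σ Φ + c)/θ²` into a rational identity modulo `σ² = -1`.

The bilinear identity is `Φ_x = θ²` cleared of denominators; it reaches the zeros of `f` by analytic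
continuation in a common phase shift. -/

/-! ### Subset sums as Cauchy determinants. -/

/-- The function `∑_S η_S ∏_{j ∈ S} z_j`, of which `f`, `g` and `fSub` are specializations. -/
noncomputable def tau {N : ℕ} (p z : Fin N → ℂ) : ℂ :=
  ∑ S : Finset (Fin N), eta p S * ∏ j ∈ S, z j

/-- The Cauchy-type matrix whose principal minors are `η_S ∏_{j ∈ S} z_j`. -/
noncomputable def kernel {N : ℕ} (p z : Fin N → ℂ) : Matrix (Fin N) (Fin N) ℂ :=
  Matrix.of fun j k => z j * (2 * p j / (p j + p k))

theorem eta_map_succ {N : ℕ} (p : Fin (N + 1) → ℂ) (S : Finset (Fin N)) :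
    eta p (S.map (Fin.succEmb N)) = eta (fun j => p j.succ) S := by
  simp [eta, Finset.prod_filter, Finset.prod_map, etaPair]

theorem eta_insert_zero {N : ℕ} (p : Fin (N + 1) → ℂ) (S : Finset (Fin N)) :
    eta p (insert 0 (S.map (Fin.succEmb N))) =
      (∏ k ∈ S, etaPair p 0 k.succ) * eta (fun j => p j.succ) S := by
  have h0 : (0 : Fin (N + 1)) ∉ S.map (Fin.succEmb N) := by simp [Fin.succ_ne_zero]
  simp [eta, Finset.prod_filter, Finset.prod_insert h0, Finset.prod_map, etaPair]

theorem tau_succ {N : ℕ} (p z : Fin (N + 1) → ℂ) :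
    tau p z = tau (fun j => p j.succ) (fun j => z j.succ) +
      z 0 * tau (fun j => p j.succ) (fun j => etaPair p 0 j.succ * z j.succ) := by
  have huniv : (univ : Finset (Fin (N + 1))) = insert 0 (univ.map (Fin.succEmb N)) := by
    ext j; refine Fin.cases ?_ (fun i => ?_) j <;> simp
  have h0 : (0 : Fin (N + 1)) ∉ univ.map (Fin.succEmb N) := by simp [Fin.succ_ne_zero]
  unfold tau
  rw [← Finset.powerset_univ, huniv, Finset.sum_powerset_insert h0]
  have hpow : (univ.map (Fin.succEmb N)).powerset =
      (univ : Finset (Finset (Fin N))).map (mapEmbedding (Fin.succEmb N)).toEmbedding := by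
    ext T
    simp only [mem_powerset, Finset.mem_map, mem_univ, true_and, subset_map_iff]
    constructor
    · rintro ⟨u, -, rfl⟩; exact ⟨u, rfl⟩
    · rintro ⟨u, rfl⟩; exact ⟨u, subset_univ _, rfl⟩
  rw [hpow, Finset.sum_map, Finset.sum_map, Finset.mul_sum]
  congr 1
  · refine sum_congr rfl fun S _ => ?_
    simp [mapEmbedding_apply, eta_map_succ, Finset.prod_map]
  · refine sum_congr rfl fun S _ => ?_
    have h1 : (0 : Fin (N + 1)) ∉ S.map (Fin.succEmb N) := by simp [Fin.succ_ne_zero]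
    simp only [RelEmbedding.coe_toEmbedding, mapEmbedding_apply, eta_insert_zero,
      Finset.prod_insert h1, Finset.prod_map, Finset.prod_mul_distrib, Fin.coe_succEmb]
    ring

/-- Eliminating the first row and column of a matrix with top left entry `1`. -/
theorem det_succ_of_zero_zero_eq_one {N : ℕ} (A : Matrix (Fin (N + 1)) (Fin (N + 1)) ℂ)
    (h : A 0 0 = 1) :
    A.det = (Matrix.of fun j k : Fin N =>
      A j.succ k.succ - A j.succ 0 * A 0 k.succ).det := by
  rw [← Matrix.det_eq_of_forall_row_eq_smul_add_const
    (A := Matrix.of fun i j => A i j - (if i = 0 then 0 else A i 0) * A 0 j)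
    (B := A) (fun i => if i = 0 then 0 else - A i 0) 0 (by simp) (fun i j => by
      by_cases hi : i = 0 <;> simp [hi]; ring)]
  rw [Matrix.det_succ_column_zero, Fin.sum_univ_succ]
  simp [h, Fin.succ_ne_zero]
  congr 1

/-- Induction along `tau_succ`: row `0` is `e_0` plus `z 0` times a Cauchy row, so the determinant
splits in the same two terms. In the second, eliminating the corner leaves a Cauchy kernel again,
because `(p_0+p_j)(p_0+p_k) - 2 p_0 (p_j+p_k) = (p_0-p_j)(p_0-p_k)`. -/
theorem one_add_kernel_det {N : ℕ} : ∀ (p z : Fin N → ℂ), (∀ j k, p j + p k ≠ 0) →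
    (1 + kernel p z).det = tau p z := by
  induction N with
  | zero => intro p z _; simp [tau, eta, univ_unique,
      Subsingleton.elim (default : Finset (Fin 0)) ∅]
  | succ N ih =>
    intro p z hp
    rw [tau_succ, ← ih _ _ fun j k => hp j.succ k.succ, ← ih _ _ fun j k => hp j.succ k.succ]
    have hrow : 1 + kernel p z = (1 + kernel p z).updateRow 0
        ((1 : Matrix (Fin (N + 1)) (Fin (N + 1)) ℂ) 0 + z 0 • kernel p 1 0) := by
      ext j k
      refine Fin.cases ?_ (fun i => ?_) j <;> simp [kernel, updateRow_apply, Fin.succ_ne_zero]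
    rw [hrow, det_updateRow_add, det_updateRow_smul]
    congr 1
    · rw [Matrix.det_succ_row_zero, Fin.sum_univ_succ]
      simp only [updateRow_self, Matrix.one_apply]
      simp only [Fin.succ_ne_zero, eq_comm, if_false]
      simp
      congr 1
      ext j k
      simp [kernel, updateRow_apply, Fin.succ_ne_zero, Matrix.one_apply]
    · congr 1
      rw [det_succ_of_zero_zero_eq_one]
      · set q : Fin N → ℂ := fun j => p j.succ
        set r : Fin N → ℂ := fun j => (p 0 - p j.succ) / (p 0 + p j.succ)
        -- Since `η_0j = r_j²`, one factor `r` can be carried to the right by `det (1 + A B) = det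
        -- (1 + B A)`. This needs no division by `r_j`, which vanishes when `p_0 = p_j`.
        have h1 : kernel q (fun j => etaPair p 0 j.succ * z j.succ) =
            diagonal r * (diagonal (fun j => r j * z j.succ) * kernel q 1) := by
          ext j k
          simp only [kernel, diagonal_mul, etaPair, r, of_apply, Pi.one_apply, q]
          field_simp
        rw [h1, det_one_add_mul_comm]
        congr 1
        ext j k
        have a1 := hp 0 j.succ
        have a2 := hp 0 k.succ
        have a3 := hp j.succ 0
        have a4 := hp j.succ k.succ
        simp [kernel, diagonal_mul, mul_diagonal, updateRow_apply, Fin.succ_ne_zero,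
          Matrix.one_apply, r, q]
        rw [add_sub_assoc, add_right_inj]
        rw [add_comm (p j.succ) (p 0)] at *
        field_simp
        ring
      · have := hp 0 0
        simp [kernel, ← two_mul] at this ⊢
        exact this

theorem f_eq_tau {N : ℕ} (p s : Fin N → ℂ) (x t : ℝ) :
    f p s x t = tau p fun j => Complex.exp (phase p s j x t) := by
  simp [f, fSub, tau, Complex.exp_sum]

theorem g_eq_tau {N : ℕ} (p s : Fin N → ℂ) (x t : ℝ) :
    g p s x t = tau p fun j => - Complex.exp (phase p s j x t) := by
  refine sum_congr rfl fun S _ => ?_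
  rw [Complex.exp_sum, Finset.prod_neg]
  ring

theorem fSub_erase_eq_tau {N : ℕ} (p s : Fin N → ℂ) (n : Fin N) (x t : ℝ) :
    fSub p s (univ.erase n) x t =
      tau p (Function.update (fun j => Complex.exp (phase p s j x t)) n 0) := by
  unfold fSub tau
  rw [← Finset.sum_subset (subset_univ (univ.erase n).powerset)]
  · refine sum_congr rfl fun S hS => ?_
    rw [Complex.exp_sum]
    congr 1
    refine prod_congr rfl fun j hj => ?_
    have : j ≠ n := by
      rintro rfl
      exact notMem_erase _ _ (mem_powerset.1 hS hj)
    simp [this]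
  · intro S _ hS
    have hn : n ∈ S := by
      by_contra hn
      exact hS (mem_powerset.2 fun j hj => mem_erase.2 ⟨fun h => hn (h ▸ hj), mem_univ _⟩)
    rw [prod_eq_zero hn (by simp), mul_zero]

/-! ### The dressed Cauchy matrix and moments of its inverse. -/

/-- The symmetric Cauchy matrix with entries `1 / (p_j + p_k)`. -/
noncomputable def cauchy {N : ℕ} (p : Fin N → ℂ) : Matrix (Fin N) (Fin N) ℂ :=
  Matrix.of fun j k => (p j + p k)⁻¹

/-- The diagonal part of `dressed`. -/
noncomputable def weight {N : ℕ} (p s : Fin N → ℂ) (x t : ℝ) (j : Fin N) : ℂ :=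
  Complex.exp (-phase p s j x t) / (2 * p j)

/-- The symmetric matrix whose inverse generates `g / f` and `H / f`. -/
noncomputable def dressed {N : ℕ} (p s : Fin N → ℂ) (x t : ℝ) : Matrix (Fin N) (Fin N) ℂ :=
  diagonal (weight p s x t) + cauchy p

/-- The moment `∑_{a,b} p_a^i X_{ab} p_b^j` of a matrix `X`. -/
noncomputable def mom {N : ℕ} (p : Fin N → ℂ) (i j : ℤ) (X : Matrix (Fin N) (Fin N) ℂ) : ℂ :=
  ∑ a, ∑ b, p a ^ i * X a b * p b ^ j

/-- The moments of the inverse of `dressed`. -/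
noncomputable def moment {N : ℕ} (p s : Fin N → ℂ) (i j : ℤ) (x t : ℝ) : ℂ :=
  mom p i j (dressed p s x t)⁻¹

/-- The matrix with all entries `1`. -/
def ones (N : ℕ) : Matrix (Fin N) (Fin N) ℂ := Matrix.of fun _ _ => 1

section mom

variable {N : ℕ} (p : Fin N → ℂ) (i j : ℤ)

theorem mom_add (X Y : Matrix (Fin N) (Fin N) ℂ) :
    mom p i j (X + Y) = mom p i j X + mom p i j Y := by
  simp [mom, mul_add, add_mul, sum_add_distrib]

theorem mom_sub (X Y : Matrix (Fin N) (Fin N) ℂ) :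
    mom p i j (X - Y) = mom p i j X - mom p i j Y := by
  simp [mom, mul_sub, sub_mul, sum_sub_distrib]

theorem mom_smul (c : ℂ) (X : Matrix (Fin N) (Fin N) ℂ) :
    mom p i j (c • X) = c * mom p i j X := by
  simp only [mom, Matrix.smul_apply, smul_eq_mul, mul_sum]
  exact sum_congr rfl fun a _ => sum_congr rfl fun b _ => by ring

variable {p}

theorem mom_diagonal_pow_mul (hp : ∀ j, p j ≠ 0) (k : ℕ) (X : Matrix (Fin N) (Fin N) ℂ) :
    mom p i j (diagonal p ^ k * X) = mom p (i + k) j X := by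
  simp only [mom, diagonal_pow, diagonal_mul]
  refine sum_congr rfl fun a _ => sum_congr rfl fun b _ => ?_
  rw [zpow_add₀ (hp a), zpow_natCast, Pi.pow_apply]; ring

theorem mom_mul_diagonal_pow (hp : ∀ j, p j ≠ 0) (k : ℕ) (X : Matrix (Fin N) (Fin N) ℂ) :
    mom p i j (X * diagonal p ^ k) = mom p i (j + k) X := by
  simp only [mom, diagonal_pow, mul_diagonal]
  refine sum_congr rfl fun a _ => sum_congr rfl fun b _ => ?_
  rw [zpow_add₀ (hp b), zpow_natCast, Pi.pow_apply]; ring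

/-- The all-ones matrix is a column times a row, so the double sum factors. This is the source of
all quadratic terms below. -/
theorem mom_mul_ones_mul (k l : ℕ) (X Y : Matrix (Fin N) (Fin N) ℂ) :
    mom p i j (X * diagonal p ^ k * ones N * diagonal p ^ l * Y) =
      mom p i k X * mom p l j Y := by
  have h (a b : Fin N) : (X * diagonal p ^ k * ones N * diagonal p ^ l * Y) a b =
      (∑ c, X a c * p c ^ k) * ∑ d, p d ^ l * Y d b := by
    simp only [Matrix.mul_assoc]
    rw [← Matrix.mul_assoc X, Matrix.mul_apply, sum_mul]
    refine sum_congr rfl fun c _ => ?_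
    rw [diagonal_pow, diagonal_pow, mul_diagonal, Matrix.mul_apply]
    simp [ones, diagonal_mul]
  have hX : mom p i k X = ∑ a, p a ^ i * ∑ c, X a c * p c ^ k := by
    simp only [mom, zpow_natCast, mul_sum, mul_assoc]
  have hY : mom p l j Y = ∑ b, (∑ d, p d ^ l * Y d b) * p b ^ j := by
    rw [mom, sum_comm]
    simp only [zpow_natCast, sum_mul]
  rw [hX, hY, sum_mul_sum, mom]
  refine sum_congr rfl fun a _ => sum_congr rfl fun b _ => ?_
  rw [h]; ring

theorem mom_transpose (X : Matrix (Fin N) (Fin N) ℂ) : mom p i j Xᵀ = mom p j i X := by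
  simp only [mom, transpose_apply]
  rw [sum_comm]
  exact sum_congr rfl fun a _ => sum_congr rfl fun b _ => by ring

end mom

/-! ### Expressing `g / f` and `H / f` by moments. -/

section algebra

variable {N : ℕ} {p : Fin N → ℂ}

theorem diagonal_mul_cauchy_add (hpp : ∀ j k, p j + p k ≠ 0) :
    diagonal p * cauchy p + cauchy p * diagonal p = ones N := by
  ext j k
  have := hpp j k
  simp [cauchy, diagonal_mul, mul_diagonal, ones]
  field_simp

variable (s : Fin N → ℂ) (x t : ℝ)

theorem dressed_transpose : (dressed p s x t)ᵀ = dressed p s x t := by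
  simp [dressed]
  ext j k
  simp [cauchy, add_comm]

theorem moment_comm (i j : ℤ) : moment p s i j x t = moment p s j i x t := by
  unfold moment
  rw [← mom_transpose, transpose_nonsing_inv, dressed_transpose]

theorem one_add_kernel_eq (hp : ∀ j, p j ≠ 0) :
    1 + kernel p (fun j => Complex.exp (phase p s j x t)) =
      diagonal (fun j => 2 * p j * Complex.exp (phase p s j x t)) * dressed p s x t := by
  ext j k
  simp only [kernel, dressed, weight, cauchy, diagonal_mul, Matrix.add_apply, of_apply,
    Matrix.one_apply, diagonal_apply, Complex.exp_neg]
  have := hp j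
  have := Complex.exp_ne_zero (phase p s j x t)
  split_ifs
  · field_simp
  · ring

theorem one_sub_kernel_eq (hp : ∀ j, p j ≠ 0) :
    1 + kernel p (fun j => -Complex.exp (phase p s j x t)) =
      diagonal (fun j => 2 * p j * Complex.exp (phase p s j x t)) *
        (diagonal (weight p s x t) - cauchy p) := by
  ext j k
  simp only [kernel, weight, cauchy, diagonal_mul, Matrix.add_apply, Matrix.sub_apply, of_apply,
    Matrix.one_apply, diagonal_apply, Complex.exp_neg]
  have := hp j
  have := Complex.exp_ne_zero (phase p s j x t)
  split_ifs <;> (field_simp; ring)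

theorem f_eq_det (hp : ∀ j, p j ≠ 0) (hpp : ∀ j k, p j + p k ≠ 0) :
    f p s x t = (∏ j, 2 * p j * Complex.exp (phase p s j x t)) * (dressed p s x t).det := by
  rw [f_eq_tau, ← one_add_kernel_det _ _ hpp, one_add_kernel_eq s x t hp, det_mul, det_diagonal]

variable {s x t}

theorem isUnit_det_dressed (hp : ∀ j, p j ≠ 0) (hpp : ∀ j k, p j + p k ≠ 0)
    (hf : f p s x t ≠ 0) : IsUnit (dressed p s x t).det := by
  rw [f_eq_det s x t hp hpp] at hf
  exact (right_ne_zero_of_mul hf).isUnit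

/-- `g / f = 1 - ∑_{a,b} p_a⁻¹ B_{ab}` where `B` is the inverse of `dressed`. -/
theorem g_eq (hp : ∀ j, p j ≠ 0) (hpp : ∀ j k, p j + p k ≠ 0) (hf : f p s x t ≠ 0) :
    g p s x t = f p s x t * (1 - moment p s (-1) 0 x t) := by
  have hM := isUnit_det_dressed hp hpp hf
  have hP : (diagonal p).det ≠ 0 := by
    rw [det_diagonal]; exact prod_ne_zero_iff.2 fun j _ => hp j
  -- As `P W = W P` and `P C + C P` is all ones, `P (W - C)` is a rank-one perturbation of `M P`,
  -- and the matrix determinant lemma applies.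
  have key : diagonal p * (diagonal (weight p s x t) - cauchy p) =
      dressed p s x t * diagonal p +
        replicateCol Unit (fun _ => (-1 : ℂ)) * replicateRow Unit (fun _ => (1 : ℂ)) := by
    have h1 : replicateCol Unit (fun _ : Fin N => (-1 : ℂ)) *
        replicateRow Unit (fun _ : Fin N => (1 : ℂ)) =
        -ones N := by
      ext; simp [ones, Matrix.mul_apply]
    rw [h1, ← diagonal_mul_cauchy_add hpp, dressed, Matrix.add_mul, Matrix.mul_sub,
      diagonal_mul_diagonal, diagonal_mul_diagonal]
    simp only [mul_comm]
    abel
  have hdet := congrArg det key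
  rw [det_mul, det_add_replicateCol_mul_replicateRow (by
    rw [det_mul]; exact hM.mul hP.isUnit), det_mul] at hdet
  have hmom : ((1 : Matrix Unit Unit ℂ) + replicateRow Unit (fun _ : Fin N => (1 : ℂ)) *
      (dressed p s x t * diagonal p)⁻¹ *
      replicateCol Unit (fun _ : Fin N => (-1 : ℂ))).det = 1 - moment p s (-1) 0 x t := by
    have hinv : (diagonal p)⁻¹ = diagonal fun j => (p j)⁻¹ := by
      apply Matrix.inv_eq_left_inv
      rw [diagonal_mul_diagonal, ← diagonal_one]
      congr 1; ext j
      exact inv_mul_cancel₀ (hp j)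
    rw [det_unique, Matrix.mul_inv_rev, hinv, moment, mom]
    simp [Matrix.mul_apply, sub_eq_add_neg, diagonal_apply]
    rw [sum_comm]
  rw [hmom] at hdet
  rw [g_eq_tau, ← one_add_kernel_det _ _ hpp, one_sub_kernel_eq s x t hp, det_mul, det_diagonal,
    f_eq_det s x t hp hpp]
  have : (diagonal (weight p s x t) - cauchy p).det =
      (dressed p s x t).det * (1 - moment p s (-1) 0 x t) :=
    mul_left_cancel₀ hP (by rw [hdet]; ring)
  rw [this]; ring

/-- Setting `z_n = 0` turns row `n` of `1 + kernel p z` into `e_n`, so the determinant becomes a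
diagonal cofactor, which is `f` times a diagonal entry of the inverse `M⁻¹ W = 1 - M⁻¹ C`. -/
theorem fSub_erase_eq (hp : ∀ j, p j ≠ 0) (hpp : ∀ j k, p j + p k ≠ 0) (hf : f p s x t ≠ 0)
    (n : Fin N) : fSub p s (univ.erase n) x t =
      f p s x t * (1 - ((dressed p s x t)⁻¹ * cauchy p) n n) := by
  have hM := isUnit_det_dressed hp hpp hf
  set z : Fin N → ℂ := fun j => Complex.exp (phase p s j x t) with hz
  have hdet : (1 + kernel p z).det = f p s x t := by
    rw [one_add_kernel_det _ _ hpp, f_eq_tau]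
  have h1 : 1 + kernel p (Function.update z n 0) =
      (1 + kernel p z).updateRow n (Pi.single n 1) := by
    ext j k
    by_cases h : j = n
    · subst h; simp [kernel, Matrix.one_apply, Pi.single_apply, eq_comm]
    · simp [kernel, h]
  have hinv : (1 + kernel p z)⁻¹ = 1 - (dressed p s x t)⁻¹ * cauchy p := by
    rw [hz, one_add_kernel_eq s x t hp]
    apply Matrix.inv_eq_left_inv
    have h2 : diagonal (fun j => 2 * p j * Complex.exp (phase p s j x t)) *
        diagonal (weight p s x t) = 1 := by
      rw [diagonal_mul_diagonal, ← diagonal_one]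
      congr 1; ext j
      have := hp j
      have := Complex.exp_ne_zero (phase p s j x t)
      simp only [weight, Complex.exp_neg]
      field_simp
    have h3 : 1 - (dressed p s x t)⁻¹ * cauchy p =
        (dressed p s x t)⁻¹ * diagonal (weight p s x t) := by
      rw [← Matrix.nonsing_inv_mul _ hM, ← Matrix.mul_sub]
      simp [dressed]
    rw [h3, Matrix.mul_assoc, ← Matrix.mul_assoc (diagonal (weight p s x t)),
      mul_eq_one_comm.1 h2, Matrix.one_mul, Matrix.nonsing_inv_mul _ hM]
  rw [fSub_erase_eq_tau, ← one_add_kernel_det _ _ hpp, h1, ← adjugate_apply]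
  have h4 : adjugate (1 + kernel p z) = f p s x t • (1 + kernel p z)⁻¹ := by
    rw [Matrix.inv_def, hdet, Ring.inverse_eq_inv', smul_smul, mul_inv_cancel₀ hf, one_smul]
  rw [h4, hinv]
  simp

theorem H_eq (hp : ∀ j, p j ≠ 0) (hpp : ∀ j k, p j + p k ≠ 0) (hf : f p s x t ≠ 0) :
    H p s x t = f p s x t * (4 * ∑ n, (p n)⁻¹ - 2 * moment p s (-1) (-1) x t) := by
  -- Symmetrize the double sum in `a, b`: `(1/p_a + 1/p_b)/(p_a + p_b) = 1/(p_a p_b)`.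
  have key : 2 * ∑ n, (p n)⁻¹ * ((dressed p s x t)⁻¹ * cauchy p) n n =
      moment p s (-1) (-1) x t := by
    set B := (dressed p s x t)⁻¹ with hB
    have hBs (a b : Fin N) : B a b = B b a := by
      have : Bᵀ = B := by rw [hB, transpose_nonsing_inv, dressed_transpose]
      exact congrFun (congrFun this b) a
    rw [two_mul, moment, ← hB, mom]
    simp only [Matrix.mul_apply, mul_sum]
    nth_rewrite 2 [sum_comm]
    simp only [← sum_add_distrib]
    refine sum_congr rfl fun a _ => sum_congr rfl fun b _ => ?_
    have := hpp a b
    have h2 : p b + p a ≠ 0 := hpp b a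
    have := hp a
    have := hp b
    rw [hBs b a]
    simp only [cauchy, of_apply, _root_.zpow_neg_one, add_comm (p b)]
    field_simp
    ring
  rw [H, ← key]
  simp only [fSub_erase_eq hp hpp hf, mul_sum, mul_sub, ← sum_sub_distrib]
  refine sum_congr rfl fun n _ => ?_
  ring

end algebra

/-! ### Differentiating the moments. -/

section inverse

attribute [local instance] Matrix.linftyOpNormedRing Matrix.linftyOpNormedAlgebra

theorem hasDerivAt_mom_inv {N : ℕ} (p : Fin N → ℂ) (i j : ℤ) (C : Matrix (Fin N) (Fin N) ℂ)
    {d : ℝ → Fin N → ℂ} {d' : Fin N → ℂ} {x : ℝ} (hd : ∀ a, HasDerivAt (fun y => d y a) (d' a) x)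
    (hx : IsUnit (diagonal (d x) + C).det) :
    HasDerivAt (fun y => mom p i j (diagonal (d y) + C)⁻¹)
      (- mom p i j ((diagonal (d x) + C)⁻¹ * diagonal d' * (diagonal (d x) + C)⁻¹)) x := by
  have h1 : HasDerivAt (fun y => diagonal (d y) + C) (diagonal d') x := by
    have := (LinearMap.toContinuousLinearMap
      (Matrix.diagonalLinearMap (Fin N) ℝ ℂ)).hasFDerivAt.comp_hasDerivAt x (hasDerivAt_pi.2 hd)
    exact this.add_const C
  obtain ⟨u, hu⟩ := (Matrix.isUnit_iff_isUnit_det _).2 hx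
  have h2 : HasFDerivAt Ring.inverse _ (diagonal (d x) + C) :=
    hu ▸ hasFDerivAt_ringInverse (𝕜 := ℝ) u
  have h3 := h2.comp_hasDerivAt x h1
  let L : Matrix (Fin N) (Fin N) ℂ →ₗ[ℝ] ℂ :=
    { toFun := mom p i j
      map_add' := mom_add p i j
      map_smul' := fun c X => by
        have := mom_smul p i j (c : ℂ) X
        simpa using this }
  have h4 := (LinearMap.toContinuousLinearMap L).hasFDerivAt.comp_hasDerivAt x h3
  have hinv : (↑u⁻¹ : Matrix (Fin N) (Fin N) ℂ) = (diagonal (d x) + C)⁻¹ := by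
    rw [← hu, Matrix.coe_units_inv]
  convert! h4 using 1
  · ext y
    simp [L, Matrix.nonsing_inv_eq_ringInverse]
  · rw [hinv]
    have := mom_smul p i j (-1) ((diagonal (d x) + C)⁻¹ * diagonal d' * (diagonal (d x) + C)⁻¹)
    simp at this
    change _ = mom p i j _
    simp [this]

end inverse

variable {N : ℕ} {p s : Fin N → ℂ} {x t : ℝ}

theorem hasDerivAt_phase_x (p s : Fin N → ℂ) (a : Fin N) (x t : ℝ) :
    HasDerivAt (fun y => phase p s a y t) (p a) x := by
  have h := Complex.ofRealCLM.hasDerivAt (x := x)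
  simp only [Complex.ofRealCLM_apply, Complex.ofReal_one] at h
  simpa [phase] using ((h.const_mul (p a)).add_const (-(1 / 4) * p a ^ 3 * (t : ℂ))).add_const (s a)

theorem hasDerivAt_phase_t (p s : Fin N → ℂ) (a : Fin N) (x t : ℝ) :
    HasDerivAt (fun τ => phase p s a x τ) (-(1 / 4) * p a ^ 3) t := by
  have h := Complex.ofRealCLM.hasDerivAt (x := t)
  simp only [Complex.ofRealCLM_apply, Complex.ofReal_one] at h
  have h2 := ((h.const_mul (-(1 / 4) * p a ^ 3)).const_add (p a * x)).add_const (s a)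
  rwa [mul_one] at h2

/-- `P` commutes with `W`, so `2 P W = P M + M P - (P C + C P)`, and the last bracket is all ones.
Conjugation removes the exponentials from the derivative of `M⁻¹`. -/
theorem mul_weight_conj (hpp : ∀ j k, p j + p k ≠ 0) (hM : IsUnit (dressed p s x t).det) :
    (2 : ℂ) • ((dressed p s x t)⁻¹ * (diagonal p * diagonal (weight p s x t)) *
      (dressed p s x t)⁻¹) =
    (dressed p s x t)⁻¹ * diagonal p + diagonal p * (dressed p s x t)⁻¹ -
      (dressed p s x t)⁻¹ * ones N * (dressed p s x t)⁻¹ := by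
  have hcomm : diagonal p * diagonal (weight p s x t) = diagonal (weight p s x t) * diagonal p := by
    simp [diagonal_mul_diagonal, mul_comm]
  have h1 : (2 : ℂ) • (diagonal p * diagonal (weight p s x t)) =
      diagonal p * dressed p s x t + dressed p s x t * diagonal p - ones N := by
    rw [two_smul, ← diagonal_mul_cauchy_add hpp, dressed, Matrix.mul_add, Matrix.add_mul]
    nth_rewrite 2 [hcomm]
    abel
  rw [← Matrix.smul_mul, ← Matrix.mul_smul, h1]
  simp only [Matrix.mul_sub, Matrix.sub_mul, Matrix.mul_add, Matrix.add_mul, ← Matrix.mul_assoc]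
  rw [Matrix.nonsing_inv_mul _ hM, Matrix.mul_assoc (_ * diagonal p),
    Matrix.mul_nonsing_inv _ hM, Matrix.mul_one, Matrix.one_mul]

/-- Entrywise this is `a³ + b³ = (a + b)(a² - a b + b²)`. -/
theorem diagonal_cube_mul_cauchy_add (hpp : ∀ j k, p j + p k ≠ 0) :
    diagonal p ^ 3 * cauchy p + cauchy p * diagonal p ^ 3 =
      diagonal p ^ 2 * ones N - diagonal p * ones N * diagonal p + ones N * diagonal p ^ 2 := by
  rw [← diagonal_mul_cauchy_add hpp]
  noncomm_ring

theorem mul_cube_weight_conj (hpp : ∀ j k, p j + p k ≠ 0) (hM : IsUnit (dressed p s x t).det) :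
    (2 : ℂ) • ((dressed p s x t)⁻¹ * (diagonal p ^ 3 * diagonal (weight p s x t)) *
      (dressed p s x t)⁻¹) =
    (dressed p s x t)⁻¹ * diagonal p ^ 3 + diagonal p ^ 3 * (dressed p s x t)⁻¹ -
      (dressed p s x t)⁻¹ * (diagonal p ^ 2 * ones N - diagonal p * ones N * diagonal p +
        ones N * diagonal p ^ 2) * (dressed p s x t)⁻¹ := by
  have hcomm : diagonal p ^ 3 * diagonal (weight p s x t) =
      diagonal (weight p s x t) * diagonal p ^ 3 := by
    simp [diagonal_mul_diagonal, diagonal_pow, mul_comm]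
  have h1 : (2 : ℂ) • (diagonal p ^ 3 * diagonal (weight p s x t)) =
      diagonal p ^ 3 * dressed p s x t + dressed p s x t * diagonal p ^ 3 -
        (diagonal p ^ 2 * ones N - diagonal p * ones N * diagonal p +
        ones N * diagonal p ^ 2) := by
    rw [two_smul, ← diagonal_cube_mul_cauchy_add hpp, dressed, Matrix.mul_add, Matrix.add_mul]
    nth_rewrite 2 [hcomm]
    abel
  rw [← Matrix.smul_mul, ← Matrix.mul_smul, h1]
  rw [Matrix.mul_sub, Matrix.sub_mul]
  congr 1
  rw [Matrix.mul_add, Matrix.add_mul, ← Matrix.mul_assoc, ← Matrix.mul_assoc,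
    Matrix.nonsing_inv_mul _ hM, Matrix.mul_assoc (_ * diagonal p ^ 3),
    Matrix.mul_nonsing_inv _ hM, Matrix.mul_one, Matrix.one_mul]

theorem mom_inv_mul_ones_mul (i j : ℤ) (k l : ℕ) :
    mom p i j ((dressed p s x t)⁻¹ * (diagonal p ^ k * ones N * diagonal p ^ l) *
      (dressed p s x t)⁻¹) = moment p s i k x t * moment p s l j x t := by
  rw [moment, moment, ← mom_mul_ones_mul]
  simp only [Matrix.mul_assoc]

theorem hasDerivAt_moment_x (hp : ∀ j, p j ≠ 0) (hpp : ∀ j k, p j + p k ≠ 0)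
    (hf : f p s x t ≠ 0) (i j : ℤ) :
    HasDerivAt (fun y => moment p s i j y t)
      ((moment p s i (j + 1) x t + moment p s (i + 1) j x t -
        moment p s i 0 x t * moment p s 0 j x t) / 2) x := by
  have hM := isUnit_det_dressed hp hpp hf
  have hd (a : Fin N) : HasDerivAt (fun y => weight p s y t a) (- (p a * weight p s x t a)) x := by
    have := ((hasDerivAt_phase_x p s a x t).neg.cexp).div_const (2 * p a)
    convert! this using 1
    simp only [weight, Pi.neg_apply]; ring
  have h := hasDerivAt_mom_inv p i j (cauchy p) (d := fun y => weight p s y t) hd hM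
  convert! h using 1
  have h1 : diagonal (fun a => -(p a * weight p s x t a)) =
      (-1 : ℂ) • (diagonal p * diagonal (weight p s x t)) := by
    rw [diagonal_mul_diagonal, neg_one_smul, diagonal_neg]
  have h2 := congrArg (mom p i j) (mul_weight_conj hpp hM)
  have h3 := mom_inv_mul_ones_mul (p := p) (s := s) (x := x) (t := t) i j 0 0
  have h4 := mom_mul_diagonal_pow i j hp 1 (dressed p s x t)⁻¹
  have h5 := mom_diagonal_pow_mul i j hp 1 (dressed p s x t)⁻¹
  simp only [pow_zero, pow_one, Matrix.one_mul, Matrix.mul_one, Nat.cast_zero, Nat.cast_one]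
    at h3 h4 h5
  rw [mom_sub, mom_add, mom_smul, h3, h4, h5] at h2
  rw [h1, ← dressed, Matrix.mul_smul, Matrix.smul_mul, mom_smul]
  have hm (i j : ℤ) : mom p i j (dressed p s x t)⁻¹ = moment p s i j x t := rfl
  simp only [hm] at h2
  linear_combination (-1 / 2 : ℂ) * h2

theorem hasDerivAt_moment_t (hp : ∀ j, p j ≠ 0) (hpp : ∀ j k, p j + p k ≠ 0)
    (hf : f p s x t ≠ 0) (i j : ℤ) :
    HasDerivAt (fun τ => moment p s i j x τ)
      (-(moment p s i (j + 3) x t + moment p s (i + 3) j x t -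
        (moment p s i 2 x t * moment p s 0 j x t - moment p s i 1 x t * moment p s 1 j x t +
        moment p s i 0 x t * moment p s 2 j x t)) / 8) t := by
  have hM := isUnit_det_dressed hp hpp hf
  have hd (a : Fin N) : HasDerivAt (fun τ => weight p s x τ a)
      (1 / 4 * (p a ^ 3 * weight p s x t a)) t := by
    have := ((hasDerivAt_phase_t p s a x t).neg.cexp).div_const (2 * p a)
    convert! this using 1
    simp only [weight, Pi.neg_apply]; ring
  have h := hasDerivAt_mom_inv p i j (cauchy p) (d := fun τ => weight p s x τ) hd hM
  convert! h using 1
  have h1 : diagonal (fun a => 1 / 4 * (p a ^ 3 * weight p s x t a)) =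
      (1 / 4 : ℂ) • (diagonal p ^ 3 * diagonal (weight p s x t)) := by
    rw [diagonal_pow, diagonal_mul_diagonal, ← diagonal_smul]; rfl
  have h2 := congrArg (mom p i j) (mul_cube_weight_conj hpp hM)
  have h3 := mom_inv_mul_ones_mul (p := p) (s := s) (x := x) (t := t) i j 2 0
  have h3' := mom_inv_mul_ones_mul (p := p) (s := s) (x := x) (t := t) i j 1 1
  have h3'' := mom_inv_mul_ones_mul (p := p) (s := s) (x := x) (t := t) i j 0 2
  have h4 := mom_mul_diagonal_pow i j hp 3 (dressed p s x t)⁻¹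
  have h5 := mom_diagonal_pow_mul i j hp 3 (dressed p s x t)⁻¹
  simp only [pow_zero, pow_one, Matrix.one_mul, Matrix.mul_one, Nat.cast_zero, Nat.cast_one,
    Nat.cast_ofNat] at h3 h3' h3'' h4 h5
  rw [mom_sub, mom_add, mom_smul, Matrix.mul_add, Matrix.mul_sub, Matrix.add_mul, Matrix.sub_mul,
    mom_add, mom_sub, h3, h3', h3'', h4, h5] at h2
  rw [h1, ← dressed, Matrix.mul_smul, Matrix.smul_mul, mom_smul]
  have hm (i j : ℤ) : mom p i j (dressed p s x t)⁻¹ = moment p s i j x t := rfl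
  simp only [hm] at h2
  linear_combination (1 / 8 : ℂ) * h2

/-- The commutator of `P²` with `M` does not see `W`, and equals the commutator of `P` with `P C + C
P`, which has rank at most two. -/
theorem moment_shift (hp : ∀ j, p j ≠ 0) (hpp : ∀ j k, p j + p k ≠ 0)
    (hf : f p s x t ≠ 0) (i j : ℤ) :
    moment p s i (j + 2) x t - moment p s (i + 2) j x t =
      moment p s i 1 x t * moment p s 0 j x t - moment p s i 0 x t * moment p s 1 j x t := by
  have hM := isUnit_det_dressed hp hpp hf
  have hcomm : diagonal p ^ 2 * diagonal (weight p s x t) =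
      diagonal (weight p s x t) * diagonal p ^ 2 := by
    simp [diagonal_mul_diagonal, diagonal_pow, mul_comm]
  have h1 : diagonal p ^ 2 * dressed p s x t - dressed p s x t * diagonal p ^ 2 =
      diagonal p * ones N - ones N * diagonal p := by
    rw [← diagonal_mul_cauchy_add hpp, dressed, Matrix.mul_add, Matrix.add_mul, hcomm]
    noncomm_ring
  have h2 := congrArg (fun X => mom p i j ((dressed p s x t)⁻¹ * X * (dressed p s x t)⁻¹)) h1
  have h3 := mom_inv_mul_ones_mul (p := p) (s := s) (x := x) (t := t) i j 1 0
  have h3' := mom_inv_mul_ones_mul (p := p) (s := s) (x := x) (t := t) i j 0 1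
  have h4 := mom_mul_diagonal_pow i j hp 2 (dressed p s x t)⁻¹
  have h5 := mom_diagonal_pow_mul i j hp 2 (dressed p s x t)⁻¹
  simp only [pow_zero, pow_one, Matrix.one_mul, Matrix.mul_one, Nat.cast_zero, Nat.cast_one,
    Nat.cast_ofNat] at h3 h3' h4 h5
  simp only [Matrix.mul_sub, Matrix.sub_mul, mom_sub, h3, h3'] at h2
  rw [← h2]
  rw [← Matrix.mul_assoc, Matrix.mul_assoc (_ * diagonal p ^ 2),
    Matrix.mul_nonsing_inv _ hM, Matrix.mul_one, ← Matrix.mul_assoc,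
    Matrix.nonsing_inv_mul _ hM, Matrix.one_mul, h4, h5]
  rfl

/-! ### Derivatives of a quotient `Ψ / θ²` with `Ψ_x = σ θ²`. -/

open Filter Topology

theorem deriv_iteratedDeriv_eq {w w1 w2 : ℝ → ℂ} {w3 : ℂ} {x : ℝ}
    (h1 : ∀ᶠ y in 𝓝 x, HasDerivAt w (w1 y) y) (h2 : ∀ᶠ y in 𝓝 x, HasDerivAt w1 (w2 y) y)
    (h3 : HasDerivAt w2 w3 x) :
    deriv w x = w1 x ∧ iteratedDeriv 2 w x = w2 x ∧ iteratedDeriv 3 w x = w3 := by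
  have e1 : deriv w =ᶠ[𝓝 x] w1 := h1.mono fun y hy => hy.deriv
  have e2 : deriv (deriv w) =ᶠ[𝓝 x] w2 :=
    e1.deriv.trans (h2.mono fun y hy => hy.deriv)
  refine ⟨e1.eq_of_nhds, ?_, ?_⟩
  · rw [iteratedDeriv_succ, iteratedDeriv_one]
    exact e2.eq_of_nhds
  · rw [iteratedDeriv_succ, iteratedDeriv_succ, iteratedDeriv_one, e2.deriv_eq, h3.deriv]

theorem deriv_iteratedDeriv_div_sq {σ c : ℂ} {θ θ₁ θ₂ Φ : ℝ → ℂ} {θ₃ : ℂ} {x : ℝ}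
    (h : ∀ᶠ y in 𝓝 x, θ y ≠ 0 ∧ HasDerivAt θ (θ₁ y) y ∧ HasDerivAt θ₁ (θ₂ y) y ∧
      HasDerivAt Φ (θ y ^ 2) y) (h3 : HasDerivAt θ₂ θ₃ x) :
    let w := fun y => (σ * Φ y + c) / θ y ^ 2
    let Ψ := σ * Φ x + c
    deriv w x = σ - 2 * θ₁ x * Ψ / θ x ^ 3 ∧
    iteratedDeriv 2 w x =
      6 * θ₁ x ^ 2 * Ψ / θ x ^ 4 - 2 * θ₂ x * Ψ / θ x ^ 3 - 2 * σ * θ₁ x / θ x ∧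
    iteratedDeriv 3 w x =
      18 * θ₁ x * θ₂ x * Ψ / θ x ^ 4 - 24 * θ₁ x ^ 3 * Ψ / θ x ^ 5 - 2 * θ₃ * Ψ / θ x ^ 3 +
        8 * σ * θ₁ x ^ 2 / θ x ^ 2 - 4 * σ * θ₂ x / θ x := by
  intro w Ψ
  refine deriv_iteratedDeriv_eq
    (w1 := fun y => σ - 2 * θ₁ y * (σ * Φ y + c) / θ y ^ 3)
    (w2 := fun y => 6 * θ₁ y ^ 2 * (σ * Φ y + c) / θ y ^ 4 - 2 * θ₂ y * (σ * Φ y + c) / θ y ^ 3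
      - 2 * σ * θ₁ y / θ y) ?_ ?_ ?_
  · filter_upwards [h] with y ⟨h0, h1, h2, hΦ⟩
    have hΨ := (hΦ.const_mul σ).add_const c
    convert! hΨ.div (h1.pow 2) (pow_ne_zero 2 h0) using 1
    simp only [Pi.pow_apply]
    field_simp
    ring
  · filter_upwards [h] with y ⟨h0, h1, h2, hΦ⟩
    have hΨ := (hΦ.const_mul σ).add_const c
    convert! (((h2.const_mul 2).mul hΨ).div (h1.pow 3) (pow_ne_zero 3 h0)).const_sub σ using 1
    simp only [Pi.pow_apply, Pi.mul_apply]
    field_simp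
    ring
  · obtain ⟨h0, h1, h2, hΦ⟩ := h.self_of_nhds
    have hΨ := (hΦ.const_mul σ).add_const c
    convert! (((((h2.pow 2).const_mul 6).mul hΨ).div (h1.pow 4) (pow_ne_zero 4 h0)).sub
      (((h3.const_mul 2).mul hΨ).div (h1.pow 3) (pow_ne_zero 3 h0))).sub
      ((h2.const_mul (2 * σ)).div h1 h0) using 1
    simp only [Pi.pow_apply, Pi.mul_apply, Ψ]
    field_simp
    ring

/-! ### The differential system for `θ = g / f` and `Φ = x + H / f`. -/

section theta

variable {N : ℕ} {p s : Fin N → ℂ} {x t : ℝ}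

/-- The quotient `g / f` in terms of moments. -/
noncomputable def theta (p s : Fin N → ℂ) (x t : ℝ) : ℂ := 1 - moment p s (-1) 0 x t

/-- The first `x`-derivative of `theta`. -/
noncomputable def theta₁ (p s : Fin N → ℂ) (x t : ℝ) : ℂ :=
  -(moment p s 0 0 x t * theta p s x t + moment p s (-1) 1 x t) / 2

/-- The second `x`-derivative of `theta`. -/
noncomputable def theta₂ (p s : Fin N → ℂ) (x t : ℝ) : ℂ :=
  theta p s x t * (moment p s 0 0 x t ^ 2 / 2 - moment p s 0 1 x t)

/-- The third `x`-derivative of `theta`. -/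
noncomputable def theta₃ (p s : Fin N → ℂ) (x t : ℝ) : ℂ :=
  theta₁ p s x t * (moment p s 0 0 x t ^ 2 / 2 - moment p s 0 1 x t) +
    theta p s x t * (moment p s 0 0 x t * (2 * moment p s 0 1 x t - moment p s 0 0 x t ^ 2) / 2 -
      (moment p s 0 2 x t + moment p s 1 1 x t - moment p s 0 0 x t * moment p s 0 1 x t) / 2)

/-- `x + H / f` in terms of moments. -/
noncomputable def prim (p s : Fin N → ℂ) (x t : ℝ) : ℂ :=
  x + (4 * ∑ n, (p n)⁻¹ - 2 * moment p s (-1) (-1) x t)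

variable (hp : ∀ j, p j ≠ 0) (hpp : ∀ j k, p j + p k ≠ 0) (hf : f p s x t ≠ 0)
include hp hpp hf

theorem theta_eq : theta p s x t = g p s x t / f p s x t := by
  rw [g_eq hp hpp hf, mul_div_cancel_left₀ _ hf, theta]

theorem prim_eq : prim p s x t = primitive p s x t := by
  rw [prim, primitive, H_eq hp hpp hf, mul_div_cancel_left₀ _ hf]

theorem moment_neg_one_two : moment p s (-1) 2 x t =
    moment p s 0 1 x t * theta p s x t + moment p s (-1) 1 x t * moment p s 0 0 x t := by
  have h := moment_shift hp hpp hf (-1) 0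
  norm_num at h
  rw [theta, moment_comm s x t 0 1]
  linear_combination h

theorem moment_neg_one_three : moment p s (-1) 3 x t =
    moment p s 1 1 x t * theta p s x t + moment p s (-1) 1 x t * moment p s 0 1 x t := by
  have h := moment_shift hp hpp hf (-1) 1
  norm_num at h
  rw [theta]
  linear_combination h

theorem hasDerivAt_theta : HasDerivAt (fun y => theta p s y t) (theta₁ p s x t) x := by
  have h := (hasDerivAt_moment_x hp hpp hf (-1) 0).const_sub 1
  norm_num at h
  convert! h using 1
  rw [theta₁, theta]; ring

/-- Eliminating `m_(-1,2)` by the shift relation is what makes the second derivative a multiple of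
`θ`, that is, a Schrödinger equation. -/
theorem hasDerivAt_theta₁ : HasDerivAt (fun y => theta₁ p s y t) (theta₂ p s x t) x := by
  have h00 := hasDerivAt_moment_x hp hpp hf 0 0
  have h11 := hasDerivAt_moment_x hp hpp hf (-1) 1
  norm_num at h00 h11
  have h := ((h00.mul (hasDerivAt_theta hp hpp hf)).add h11).neg.div_const 2
  convert! h using 1
  rw [moment_neg_one_two hp hpp hf, moment_comm s x t 1 0, theta₁, theta₂, theta]
  ring

theorem hasDerivAt_theta₂ : HasDerivAt (fun y => theta₂ p s y t) (theta₃ p s x t) x := by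
  have h00 := hasDerivAt_moment_x hp hpp hf 0 0
  have h01 := hasDerivAt_moment_x hp hpp hf 0 1
  norm_num at h00 h01
  have h := (hasDerivAt_theta hp hpp hf).mul (((h00.pow 2).div_const 2).sub h01)
  convert! h using 1
  simp only [Pi.pow_apply, Pi.sub_apply]
  rw [moment_comm s x t 1 0, theta₃]
  push_cast
  ring

/-- In terms of `x`-derivatives the right side is `(2 u θ_x - u_x θ)/4` with `u = m_00²/2 - m_01`;
for `θ ≠ 0` this is `(3 θ_x θ_xx / θ - θ_xxx)/4`. -/
theorem hasDerivAt_theta_t : HasDerivAt (fun τ => theta p s x τ)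
    ((theta p s x t * (moment p s 1 1 x t + moment p s 0 2 x t) +
      2 * moment p s (-1) 1 x t * moment p s 0 1 x t -
      theta p s x t * moment p s 0 1 x t * moment p s 0 0 x t -
      moment p s (-1) 1 x t * moment p s 0 0 x t ^ 2) / 8) t := by
  have h := (hasDerivAt_moment_t hp hpp hf (-1) 0).const_sub 1
  norm_num at h
  convert! h using 1
  rw [moment_neg_one_two hp hpp hf, moment_neg_one_three hp hpp hf, moment_comm s x t 1 0,
    moment_comm s x t 2 0, theta]
  ring

/-- By symmetry of the moments the derivative is `1 - 2 m_(-1,0) + m_(-1,0)²`, a perfect square. -/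
theorem hasDerivAt_prim : HasDerivAt (fun y => prim p s y t) (theta p s x t ^ 2) x := by
  have h := (hasDerivAt_moment_x hp hpp hf (-1) (-1)).const_mul 2
  have hx := Complex.ofRealCLM.hasDerivAt (x := x)
  simp only [Complex.ofRealCLM_apply, Complex.ofReal_one] at hx
  norm_num at h
  convert! hx.add (h.const_sub (4 * ∑ n, (p n)⁻¹)) using 1
  rw [moment_comm s x t 0 (-1), theta]
  ring

theorem hasDerivAt_prim_t : HasDerivAt (fun τ => prim p s x τ)
    (theta₁ p s x t ^ 2 - theta p s x t * theta₂ p s x t / 2) t := by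
  have h := (hasDerivAt_moment_t hp hpp hf (-1) (-1)).const_mul 2
  norm_num at h
  convert! (h.const_sub (4 * ∑ n, (p n)⁻¹)).const_add (x : ℂ) using 1
  rw [moment_comm s x t 0 (-1), moment_comm s x t 1 (-1), moment_comm s x t 2 (-1),
    moment_neg_one_two hp hpp hf, theta₁, theta₂, theta]
  ring

end theta

/-! ### Smoothness and openness. -/

section smooth

variable {N : ℕ} (p s : Fin N → ℂ)

theorem contDiff_phase (j : Fin N) : ContDiff ℝ ∞ fun z : ℝ × ℝ => phase p s j z.1 z.2 := by
  have h1 : ContDiff ℝ ∞ fun z : ℝ × ℝ => (z.1 : ℂ) := Complex.ofRealCLM.contDiff.comp contDiff_fst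
  have h2 : ContDiff ℝ ∞ fun z : ℝ × ℝ => (z.2 : ℂ) := Complex.ofRealCLM.contDiff.comp contDiff_snd
  unfold phase
  fun_prop

theorem contDiff_exp_sum_phase (S : Finset (Fin N)) :
    ContDiff ℝ ∞ fun z : ℝ × ℝ => Complex.exp (∑ j ∈ S, phase p s j z.1 z.2) :=
  (ContDiff.sum fun j _ => contDiff_phase p s j).cexp

theorem contDiff_fSub (A : Finset (Fin N)) :
    ContDiff ℝ ∞ fun z : ℝ × ℝ => fSub p s A z.1 z.2 :=
  ContDiff.sum fun S _ => contDiff_const.mul (contDiff_exp_sum_phase p s S)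

theorem contDiff_f : ContDiff ℝ ∞ fun z : ℝ × ℝ => f p s z.1 z.2 :=
  contDiff_fSub p s univ

theorem contDiff_g : ContDiff ℝ ∞ fun z : ℝ × ℝ => g p s z.1 z.2 :=
  ContDiff.sum fun S _ => contDiff_const.mul (contDiff_exp_sum_phase p s S)

theorem contDiff_H : ContDiff ℝ ∞ fun z : ℝ × ℝ => H p s z.1 z.2 :=
  contDiff_const.mul (ContDiff.sum fun n _ => (contDiff_fSub p s (univ.erase n)).div_const (p n))

theorem contDiffOn_wOf (σ c : ℂ) : ContDiffOn ℝ ∞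
    (fun z : ℝ × ℝ => wOf σ c p s (primitive p s) z.1 z.2)
    {z | f p s z.1 z.2 ≠ 0 ∧ g p s z.1 z.2 ≠ 0} := by
  have hf := (contDiff_f p s).contDiffOn (s := {z | f p s z.1 z.2 ≠ 0 ∧ g p s z.1 z.2 ≠ 0})
  have hg := (contDiff_g p s).contDiffOn (s := {z | f p s z.1 z.2 ≠ 0 ∧ g p s z.1 z.2 ≠ 0})
  have hH := (contDiff_H p s).contDiffOn (s := {z | f p s z.1 z.2 ≠ 0 ∧ g p s z.1 z.2 ≠ 0})
  have hx : ContDiff ℝ ∞ fun z : ℝ × ℝ => (z.1 : ℂ) := Complex.ofRealCLM.contDiff.comp contDiff_fst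
  have hq := (hf.mul (hg.inv fun z hz => hz.2)).pow 2
  exact ((contDiffOn_const.mul hq).mul (hx.contDiffOn.add
    (hH.mul (hf.inv fun z hz => hz.1)))).add (contDiffOn_const.mul hq)

theorem isOpen_wOf_ne_zero (σ c : ℂ) : IsOpen {z : ℝ × ℝ | f p s z.1 z.2 ≠ 0 ∧ g p s z.1 z.2 ≠ 0 ∧
    wOf σ c p s (primitive p s) z.1 z.2 ≠ 0} := by
  have h1 : IsOpen {z : ℝ × ℝ | f p s z.1 z.2 ≠ 0 ∧ g p s z.1 z.2 ≠ 0} :=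
    (isOpen_ne_fun (contDiff_f p s).continuous continuous_const).inter
      (isOpen_ne_fun (contDiff_g p s).continuous continuous_const)
  have h2 := (contDiffOn_wOf p s σ c).continuousOn.isOpen_inter_preimage h1
    (isOpen_compl_singleton (x := (0 : ℂ)))
  convert! h2 using 1
  ext z
  exact and_assoc.symm

end smooth

/-! ### The equation, the bilinear identity and the antiderivatives. -/

section main

variable {N : ℕ} {p s : Fin N → ℂ}

theorem eventually_ne_zero_x {F : ℝ → ℝ → ℂ}
    (hF : ContDiff ℝ ∞ fun z : ℝ × ℝ => F z.1 z.2) {x t : ℝ} (h : F x t ≠ 0) :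
    ∀ᶠ y in 𝓝 x, F y t ≠ 0 :=
  (hF.continuous.comp (continuous_id.prodMk continuous_const)).continuousAt.eventually_ne h

theorem eventually_ne_zero_t {F : ℝ → ℝ → ℂ}
    (hF : ContDiff ℝ ∞ fun z : ℝ × ℝ => F z.1 z.2) {x t : ℝ} (h : F x t ≠ 0) :
    ∀ᶠ τ in 𝓝 t, F x τ ≠ 0 :=
  (hF.continuous.comp (continuous_const.prodMk continuous_id)).continuousAt.eventually_ne h

theorem hasDerivAt_primitive (hp : ∀ j, p j ≠ 0) (hpp : ∀ j k, p j + p k ≠ 0) {x t : ℝ}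
    (hf : f p s x t ≠ 0) :
    HasDerivAt (fun y => primitive p s y t) ((g p s x t / f p s x t) ^ 2) x := by
  rw [← theta_eq hp hpp hf]
  refine (hasDerivAt_prim hp hpp hf).congr_of_eventuallyEq ?_
  filter_upwards [eventually_ne_zero_x (contDiff_f p s) hf] with y hy
  exact (prim_eq hp hpp hy).symm

theorem wOf_eq (hp : ∀ j, p j ≠ 0) (hpp : ∀ j k, p j + p k ≠ 0) (σ c : ℂ) {x t : ℝ}
    (hf : f p s x t ≠ 0) :
    wOf σ c p s (primitive p s) x t = (σ * prim p s x t + c) / theta p s x t ^ 2 := by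
  rw [wOf, prim_eq hp hpp hf, theta_eq hp hpp hf, ← inv_div (g p s x t)]
  ring

theorem solvesCKdVOn_wOf (hp : ∀ j, p j ≠ 0) (hpp : ∀ j k, p j + p k ≠ 0) {σ : ℂ}
    (hσ : σ ^ 2 = -1) (c : ℂ) :
    SolvesCKdVOn (wOf σ c p s (primitive p s))
      {z : ℝ × ℝ | f p s z.1 z.2 ≠ 0 ∧ g p s z.1 z.2 ≠ 0 ∧
        wOf σ c p s (primitive p s) z.1 z.2 ≠ 0} := by
  refine ⟨isOpen_wOf_ne_zero p s σ c, (contDiffOn_wOf p s σ c).mono fun z hz => ⟨hz.1, hz.2.1⟩, ?_⟩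
  rintro x t ⟨hf, hg, hw⟩
  simp only at hf hg hw
  refine ⟨hw, ?_⟩
  have hfx := eventually_ne_zero_x (contDiff_f p s) hf
  have hgx := eventually_ne_zero_x (contDiff_g p s) hg
  have hft := eventually_ne_zero_t (contDiff_f p s) hf
  have hθ : theta p s x t ≠ 0 := by rw [theta_eq hp hpp hf]; exact div_ne_zero hg hf
  have ex : (fun y => wOf σ c p s (primitive p s) y t) =ᶠ[𝓝 x]
      fun y => (σ * prim p s y t + c) / theta p s y t ^ 2 :=
    hfx.mono fun y hy => wOf_eq hp hpp σ c hy
  have et : (fun τ => wOf σ c p s (primitive p s) x τ) =ᶠ[𝓝 t]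
      fun τ => (σ * prim p s x τ + c) / theta p s x τ ^ 2 :=
    hft.mono fun τ hy => wOf_eq hp hpp σ c hy
  have hx : ∀ᶠ y in 𝓝 x, theta p s y t ≠ 0 ∧
      HasDerivAt (fun y => theta p s y t) (theta₁ p s y t) y ∧
      HasDerivAt (fun y => theta₁ p s y t) (theta₂ p s y t) y ∧
      HasDerivAt (fun y => prim p s y t) (theta p s y t ^ 2) y := by
    filter_upwards [hfx, hgx] with y hy hgy
    refine ⟨?_, hasDerivAt_theta hp hpp hy, hasDerivAt_theta₁ hp hpp hy, hasDerivAt_prim hp hpp hy⟩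
    rw [theta_eq hp hpp hy]; exact div_ne_zero hgy hy
  obtain ⟨d1, d2, d3⟩ := deriv_iteratedDeriv_div_sq (σ := σ) (c := c) hx
    (hasDerivAt_theta₂ hp hpp hf)
  have dt := ((((hasDerivAt_prim_t hp hpp hf).const_mul σ).add_const c).div
    ((hasDerivAt_theta_t hp hpp hf).pow 2) (pow_ne_zero 2 hθ)).deriv
  rw [ex.deriv_eq, ex.iteratedDeriv_eq, ex.iteratedDeriv_eq, et.deriv_eq, d1, d2, d3]
  rw [wOf_eq hp hpp σ c hf] at hw ⊢
  have hΨ : σ * prim p s x t + c ≠ 0 := fun h => hw (by rw [h, zero_div])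
  -- The time derivative is rewritten through `x`-derivatives of `θ` only, so that the moments can
  -- be forgotten.
  have dt' : deriv (fun τ => (σ * prim p s x τ + c) / theta p s x τ ^ 2) t =
      σ * (theta₁ p s x t ^ 2 - theta p s x t * theta₂ p s x t / 2) / theta p s x t ^ 2 -
      (3 * theta₁ p s x t * theta₂ p s x t / theta p s x t - theta₃ p s x t) / 2 *
        (σ * prim p s x t + c) / theta p s x t ^ 3 := by
    refine dt.trans ?_
    simp only [Pi.pow_apply, theta₃, theta₂, theta₁]
    field_simp
    ring
  rw [dt']
  generalize σ * prim p s x t + c = Ψ at *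
  generalize theta p s x t = θ at *
  generalize theta₁ p s x t = θ₁ at *
  generalize theta₂ p s x t = θ₂ at *
  generalize theta₃ p s x t = θ₃ at *
  -- The term `3 w_x / (8 w²)` is the only one not matching the rest in powers of `σ`; replacing it
  -- by `-σ²` times itself leaves an identity in free `σ, Ψ, θ, θ₁, θ₂, θ₃`.
  linear_combination
    (3 * (σ - 2 * θ₁ * Ψ / θ ^ 3) / (8 * (Ψ / θ ^ 2) ^ 2)) * hσ + (by field_simp; ring :
      σ * (θ₁ ^ 2 - θ * θ₂ / 2) / θ ^ 2 - (3 * θ₁ * θ₂ / θ - θ₃) / 2 * Ψ / θ ^ 3 +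
      1 / 4 * (18 * θ₁ * θ₂ * Ψ / θ ^ 4 - 24 * θ₁ ^ 3 * Ψ / θ ^ 5 - 2 * θ₃ * Ψ / θ ^ 3 +
        8 * σ * θ₁ ^ 2 / θ ^ 2 - 4 * σ * θ₂ / θ)
      - 3 * (σ - 2 * θ₁ * Ψ / θ ^ 3) / (8 * (Ψ / θ ^ 2) ^ 2) * σ ^ 2
      + 3 * (σ - 2 * θ₁ * Ψ / θ ^ 3) ^ 3 / (8 * (Ψ / θ ^ 2) ^ 2)
      - 3 * (σ - 2 * θ₁ * Ψ / θ ^ 3) * (6 * θ₁ ^ 2 * Ψ / θ ^ 4 - 2 * θ₂ * Ψ / θ ^ 3 - 2 * σ * θ₁ / θ)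
        / (4 * (Ψ / θ ^ 2)) = 0)

/-- `f` is not identically zero in the family obtained by shifting all phase constants. -/
theorem exists_f_shift_ne_zero (p s : Fin N → ℂ) (x t : ℝ) :
    ∃ τ : ℂ, f p (fun j => s j + τ) x t ≠ 0 := by
  let F : ℂ → ℂ := fun ζ => tau p fun j => ζ * Complex.exp (phase p s j x t)
  have hF : Continuous F := by unfold F tau; fun_prop
  have h0 : F 0 = 1 := by
    simp only [F, tau, zero_mul]
    rw [Finset.sum_eq_single ∅]
    · simp [eta]
    · intro S _ hS
      simp [hS]
    · simp
  -- The neighbourhood is punctured because `ζ = exp τ` must be nonzero to have a logarithm.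
  have h1 : ∀ᶠ ζ in 𝓝[≠] (0 : ℂ), F ζ ≠ 0 :=
    (hF.continuousAt.eventually_ne (by rw [h0]; exact one_ne_zero)).filter_mono nhdsWithin_le_nhds
  obtain ⟨ζ, hζ, hζ0⟩ := (h1.and self_mem_nhdsWithin).exists
  refine ⟨Complex.log ζ, ?_⟩
  have h2 : (fun j => Complex.exp (phase p (fun j => s j + Complex.log ζ) j x t)) =
      fun j => ζ * Complex.exp (phase p s j x t) := by
    funext j
    have : phase p (fun j => s j + Complex.log ζ) j x t = Complex.log ζ + phase p s j x t := by
      simp only [phase]; ring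
    rw [this, Complex.exp_add, Complex.exp_log hζ0]
  rw [f_eq_tau, h2]
  exact hζ

theorem hasDerivAt_fSub (p s : Fin N → ℂ) (A : Finset (Fin N)) (x t : ℝ) :
    HasDerivAt (fun y => fSub p s A y t)
      (∑ S ∈ A.powerset, eta p S * (Complex.exp (∑ j ∈ S, phase p s j x t) * ∑ j ∈ S, p j)) x :=
  HasDerivAt.fun_sum fun S _ =>
    ((HasDerivAt.fun_sum fun j _ => hasDerivAt_phase_x p s j x t).cexp).const_mul (eta p S)

theorem differentiable_fSub_shift (p s : Fin N → ℂ) (A : Finset (Fin N)) (x t : ℝ) :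
    Differentiable ℂ fun τ => fSub p (fun j => s j + τ) A x t := by
  unfold fSub phase; fun_prop

theorem differentiable_deriv_fSub_shift (p s : Fin N → ℂ) (A : Finset (Fin N)) (x t : ℝ) :
    Differentiable ℂ fun τ => deriv (fun y => fSub p (fun j => s j + τ) A y t) x := by
  simp only [(hasDerivAt_fSub _ _ _ _ _).deriv]
  unfold phase; fun_prop

theorem hasDerivAt_H (p s : Fin N → ℂ) (x t : ℝ) :
    HasDerivAt (fun y => H p s y t)
      (4 * ∑ n, deriv (fun y => fSub p s (univ.erase n) y t) x / p n) x :=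
  (HasDerivAt.fun_sum fun n _ =>
    (hasDerivAt_fSub p s (univ.erase n) x t).differentiableAt.hasDerivAt.div_const (p n)).const_mul 4

theorem bilinear_of_ne_zero (hp : ∀ j, p j ≠ 0) (hpp : ∀ j k, p j + p k ≠ 0) {x t : ℝ}
    (hf : f p s x t ≠ 0) :
    deriv (fun y => H p s y t) x * f p s x t - H p s x t * deriv (fun y => f p s y t) x
      + f p s x t ^ 2 - g p s x t ^ 2 = 0 := by
  have h1 := hasDerivAt_primitive hp hpp hf
  have hx := Complex.ofRealCLM.hasDerivAt (x := x)
  simp only [Complex.ofRealCLM_apply, Complex.ofReal_one] at hx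
  have h2 := hx.add ((hasDerivAt_H p s x t).differentiableAt.hasDerivAt.div
    (hasDerivAt_fSub p s univ x t).differentiableAt.hasDerivAt hf)
  have h3 := h1.unique h2
  change _ = 1 + (_ * f p s x t - H p s x t * deriv (fun y => f p s y t) x) / f p s x t ^ 2 at h3
  field_simp at h3
  linear_combination -h3

/-- Adding a complex `τ` to every `s j` makes the left side entire in `τ`. It vanishes near some
`τ₀` where `f ≠ 0`, hence everywhere, in particular at `τ = 0`. -/
theorem bilinear (hp : ∀ j, p j ≠ 0) (hpp : ∀ j k, p j + p k ≠ 0) (s : Fin N → ℂ) (x t : ℝ) :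
    deriv (fun y => H p s y t) x * f p s x t - H p s x t * deriv (fun y => f p s y t) x
      + f p s x t ^ 2 - g p s x t ^ 2 = 0 := by
  let E : ℂ → ℂ := fun τ =>
    deriv (fun y => H p (fun j => s j + τ) y t) x * f p (fun j => s j + τ) x t -
      H p (fun j => s j + τ) x t * deriv (fun y => f p (fun j => s j + τ) y t) x
      + f p (fun j => s j + τ) x t ^ 2 - g p (fun j => s j + τ) x t ^ 2
  have hf : Differentiable ℂ fun τ => f p (fun j => s j + τ) x t :=
    differentiable_fSub_shift p s univ x t
  have hf' : Differentiable ℂ fun τ => deriv (fun y => f p (fun j => s j + τ) y t) x :=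
    differentiable_deriv_fSub_shift p s univ x t
  have hg : Differentiable ℂ fun τ => g p (fun j => s j + τ) x t := by
    unfold g phase; fun_prop
  have hH : Differentiable ℂ fun τ => H p (fun j => s j + τ) x t := by
    have := fun n => differentiable_fSub_shift p s (univ.erase n) x t
    unfold H; fun_prop
  have hH' : Differentiable ℂ fun τ => deriv (fun y => H p (fun j => s j + τ) y t) x := by
    have := fun n => differentiable_deriv_fSub_shift p s (univ.erase n) x t
    simp only [(hasDerivAt_H _ _ _ _).deriv]
    fun_prop
  have hE : Differentiable ℂ E := by unfold E; fun_prop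
  obtain ⟨τ₀, h0⟩ := exists_f_shift_ne_zero p s x t
  have hloc : E =ᶠ[𝓝 τ₀] 0 := by
    filter_upwards [hf.continuous.continuousAt.eventually_ne h0] with τ hτ
    exact bilinear_of_ne_zero hp hpp hτ
  have hzero := AnalyticOnNhd.eq_of_eventuallyEq (fun z _ => hE.analyticAt z)
    (fun z _ => analyticAt_const (v := (0 : ℂ))) hloc
  have := congrFun hzero 0
  simpa [E] using this

theorem antiderivative_iff (hp : ∀ j, p j ≠ 0) (hpp : ∀ j k, p j + p k ≠ 0) (t : ℝ) (J : Set ℝ)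
    (hJ : IsOpen J) (hJc : J.OrdConnected) (hf : ∀ x ∈ J, f p s x t ≠ 0) (Φ : ℝ → ℂ) :
    (∀ x ∈ J, HasDerivAt Φ ((f p s x t / g p s x t) ^ (-2 : ℤ)) x) ↔
      ∃ C : ℂ, ∀ x ∈ J, Φ x = (x : ℂ) + H p s x t / f p s x t + C := by
  -- This also holds at zeros of `g`: with division by zero equal to zero, both sides are then `0`,
  -- the intended value of `g² / f²`.
  have hz (x : ℝ) : (f p s x t / g p s x t) ^ (-2 : ℤ) = (g p s x t / f p s x t) ^ 2 := by
    rw [_root_.zpow_neg, ← _root_.inv_zpow, inv_div]; norm_cast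
  simp only [hz]
  constructor
  · intro h
    rcases J.eq_empty_or_nonempty with rfl | ⟨x₀, hx₀⟩
    · exact ⟨0, by simp⟩
    have hd (x : ℝ) (hx : x ∈ J) : HasDerivAt (fun y => Φ y - primitive p s y t) 0 x := by
      have := (h x hx).sub (hasDerivAt_primitive hp hpp (hf x hx))
      rwa [sub_self] at this
    refine ⟨Φ x₀ - primitive p s x₀ t, fun x hx => ?_⟩
    have hc := hJ.is_const_of_deriv_eq_zero hJc.isPreconnected
      (fun y hy => (hd y hy).differentiableAt.differentiableWithinAt)
      (fun y hy => (hd y hy).deriv) hx hx₀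
    simp only [primitive] at hc ⊢
    linear_combination hc
  · rintro ⟨C, hC⟩ x hx
    refine ((hasDerivAt_primitive hp hpp (hf x hx)).add_const C).congr_of_eventuallyEq ?_
    filter_upwards [hJ.mem_nhds hx] with y hy
    exact hC y hy

end main

end CKdV

theorem mainTheorem6 (N : ℕ) (p s : Fin N → ℂ)
    (hp : ∀ j, p j ≠ 0) (hpp : ∀ j k, j ≠ k → p j + p k ≠ 0)
    (σ : ℂ) (hσ : σ = Complex.I ∨ σ = -Complex.I) :
    -- the differentiated form of the integral formula
    (∀ x t : ℝ,
      deriv (fun y => CKdV.H p s y t) x * CKdV.f p s x t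
        - CKdV.H p s x t * deriv (fun y => CKdV.f p s y t) x
        + CKdV.f p s x t ^ 2 - CKdV.g p s x t ^ 2 = 0) ∧
    -- the indefinite integral of `(f/g)⁻²` in `x` is `x + H/f`, up to an additive constant
    (∀ (t : ℝ) (J : Set ℝ), IsOpen J → J.OrdConnected → (∀ x ∈ J, CKdV.f p s x t ≠ 0) →
      ∀ Φ : ℝ → ℂ,
        (∀ x ∈ J, HasDerivAt Φ ((CKdV.f p s x t / CKdV.g p s x t) ^ (-2 : ℤ)) x) ↔
          ∃ C : ℂ, ∀ x ∈ J, Φ x = (x : ℂ) + CKdV.H p s x t / CKdV.f p s x t + C) ∧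
    -- with this integral, `w_N` solves the equation wherever it is defined and nonzero
    (∀ c : ℂ,
      CKdV.SolvesCKdVOn (CKdV.wOf σ c p s (CKdV.primitive p s))
        {z : ℝ × ℝ | CKdV.f p s z.1 z.2 ≠ 0 ∧ CKdV.g p s z.1 z.2 ≠ 0 ∧
          CKdV.wOf σ c p s (CKdV.primitive p s) z.1 z.2 ≠ 0}) := by
  have hpp' (j k : Fin N) : p j + p k ≠ 0 := by
    rcases eq_or_ne j k with rfl | h
    · rw [← two_mul]; exact mul_ne_zero two_ne_zero (hp j)
    · exact hpp j k h
  refine ⟨CKdV.bilinear hp hpp' s, CKdV.antiderivative_iff hp hpp',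
    CKdV.solvesCKdVOn_wOf hp hpp' ?_⟩
  rcases hσ with rfl | rfl <;> simp
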